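/- Let $G$ be a locally finite plane graph (loops and parallel edges are allowed), drawn in the plane with pairwise distinct vertices and with edges that are polygonal arcs meeting each other and the vertices only in their ends. At every vertex $v$ the drawing gives the counterclockwise cyclic order $C_v$ of the edges incident with $v$ (a loop counts twice). Let $G^*$ be the dual: its vertices are the faces of $G$, given by their boundary walks, it has the same edge set as $G$, each edge $e$ joining the faces on its two sides, and the edges at a face are cyclically ordered as they appear on its boundary walk. Assume that $G^*$ is locally finite too, that is, all boundary walks of faces are finite. The roundabout graph $\mathring{H}$ of $H\in\{G,G^*\}$ is obtained by replacing each vertex by a cycle: its vertices are the pairs $(v,e)$ with $e$ an edge of $H$ and $v$ an endvertex of $e$ (two such pairs for a loop, one for each end); each edge $e=vw$ of $H$ gives an edge joining $(v,e)$ and $(w,e)$, and whenever $e'$ is the successor of $e$ in $C_v$ there is an edge joining $(v,e)$ and $(v,e')$, so that every vertex has degree $3$. Thus $E(H)\subseteq E(\mathring{H})$, and the edges that $\mathring{G}$ and $\mathring{G^*}$ have in common are exactly those of $E(G)=E(G^*)$. A flow is an antisymmetric real function $i$ on the directed edges that satisfies Kirchhoff's node law at every vertex, and its energy is $\sum_{\vec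 e} i(\vec e)^2$. Theorem. If there are flows $f$ in $\mathring{G}$ and $h$ in $\mathring{G^*}$, both of finite energy, whose supports intersect in a single edge (of $E(G)=E(G^*)$), then $G$ admits a non-constant Dirichlet harmonic function, that is, a non-constant function $u:V(G)\to\mathbb{R}$ such that $u(x)$ is the average of $u$ over the neighbours of $x$ (counted with multiplicity of edges) for every vertex $x$, and $\sum_{xy\in E(G)}(u(x)-u(y))^2<\infty$. No assumption on the number of ends of $G$ or $G^*$ is made. -/

import Mathlib

/-- A multigraph with vertex type `V` and type `D` of directed edges ("darts"). A dart `d` points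
from `tail d` to `tail (inv d)`, and `inv d` is the same edge with the opposite direction, so that
the undirected edges are the pairs `{d, inv d}`. Loops and parallel edges are allowed. -/
structure Multigraph (V D : Type*) where
  tail : D → V
  inv : D → D
  inv_involutive : Function.Involutive inv
  inv_ne : ∀ d, inv d ≠ d

namespace Multigraph

variable {V D : Type*} (G : Multigraph V D)

def head (d : D) : V := G.tail (G.inv d)

/-- The darts starting at `x`. -/
def star (x : V) : Set D := {d | G.tail d = x}

def LocallyFinite : Prop := ∀ x, (G.star x).Finite

/-- A flow: an antisymmetric function on directed edges that satisfies Kirchhoff's node law at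
every vertex (used for locally finite graphs, so that the sums are finite). -/
structure IsFlow (f : D → ℝ) : Prop where
  antisymm : ∀ d, f (G.inv d) = - f d
  kirchhoff : ∀ x, ∑ᶠ d ∈ G.star x, f d = 0

/-- The value of `u` at every vertex is the average of its values at the neighbours, counted with
the multiplicity of the edges (stated without a division). -/
def IsHarmonic (u : V → ℝ) : Prop :=
  ∀ x, ((G.star x).ncard : ℝ) * u x = ∑ᶠ d ∈ G.star x, u (G.head d)

/-- A harmonic function with finite Dirichlet energy. -/
def IsDirichletHarmonic (u : V → ℝ) : Prop :=
  G.IsHarmonic u ∧ Summable fun d => (u (G.tail d) - u (G.head d)) ^ 2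

end Multigraph

/-- A function on directed edges has finite energy. -/
def FiniteEnergy {D : Type*} (f : D → ℝ) : Prop := Summable fun d => f d ^ 2

/-- A multigraph with, at every vertex, a cyclic order of the darts starting there: `rot d` is the
successor of `d` in the cyclic order at `tail d`. -/
structure RotationSystem (V D : Type*) extends Multigraph V D where
  rot : Equiv.Perm D
  sameCycle_iff : ∀ d d', rot.SameCycle d d' ↔ tail d = tail d'

/-- The directed edges of the roundabout graph. The edge `edge d` is the original edge `d`, now
joining `(tail d, d)` to `(head d, inv d)`; `fwd d` runs along the roundabout of `tail d` from `d`
to its successor `rot d`, and `bwd d` is its reverse. -/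
inductive RoundaboutDart (D : Type*)
  | edge (d : D)
  | fwd (d : D)
  | bwd (d : D)

namespace RotationSystem

variable {V D : Type*} (G : RotationSystem V D)

/-- The roundabout graph. A pair of an edge and one of its endvertices is the same thing as a dart,
so its vertices are the darts. Every vertex `x` of `G` is replaced by a cycle through the darts
starting at `x`, in their cyclic order; every vertex has degree 3. -/
def roundabout : Multigraph D (RoundaboutDart D) where
  tail
    | .edge d => d
    | .fwd d => d
    | .bwd d => G.rot d
  inv
    | .edge d => .edge (G.inv d)
    | .fwd d => .bwd d
    | .bwd d => .fwd d
  inv_involutive := by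
    rintro (d | d | d)
    · simp [G.inv_involutive d]
    · rfl
    · rfl
  inv_ne := by
    rintro (d | d | d)
    · simpa using G.inv_ne d
    · simp
    · simp

/-- The facial permutation, for counterclockwise `rot`: after traversing `d`, turn at its head into
the dart that precedes `inv d` there. Its cycles are the boundary walks of the faces, each face
lying to the left of its walk. -/
def facePerm : Equiv.Perm D := G.rot⁻¹ * G.inv_involutive.toPerm

def Face : Type _ := Quotient (Equiv.Perm.SameCycle.setoid G.facePerm)

/-- The dual: its vertices are the faces, it has the same edges, and the dual of `d` leads from the
face to the left of `d` to the face to the right of `d`. The edges at a face are cyclically ordered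
as they appear on the boundary walk of the face. -/
def dual : RotationSystem G.Face D where
  tail d := Quotient.mk (Equiv.Perm.SameCycle.setoid G.facePerm) d
  inv := G.inv
  inv_involutive := G.inv_involutive
  inv_ne := G.inv_ne
  rot := G.facePerm
  sameCycle_iff _ _ :=
    (Quotient.eq (r := Equiv.Perm.SameCycle.setoid G.facePerm)).symm

end RotationSystem

/-- The angle in `(0, 2π]` by which one turns counterclockwise from the direction of `z` to that
of `w` (both non-zero); it is a full turn if the directions agree. -/
noncomputable def ccwAngle (z w : ℂ) : ℝ :=
  toIocMod Real.two_pi_pos 0 (Complex.arg (w / z))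

/-- A plane multigraph. Vertices are distinct points of the plane and edges are polygonal arcs
(closed polygons, for loops) that meet vertices only in their ends and do not meet each other in
inner points. The arc of `d` runs through the points `pt d 0, …, pt d (len d)`; its inner points are
`AffineMap.lineMap (pt d i) (pt d (i + 1)) t` with `i < len d`, `0 ≤ t < 1` and `(i, t) ≠ (0, 0)`.
The rotation system is the counterclockwise order in which the arcs leave a vertex. -/
structure PlaneGraph (V D : Type*) extends RotationSystem V D where
  pos : V → ℂ
  pos_injective : Function.Injective pos
  len : D → ℕ
  pt : D → ℕ → ℂ
  len_pos : ∀ d, 0 < len d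
  len_inv : ∀ d, len (inv d) = len d
  pt_zero : ∀ d, pt d 0 = pos (tail d)
  pt_inv : ∀ d, ∀ i ≤ len d, pt (inv d) i = pt d (len d - i)
  inner_ne_pos : ∀ d, ∀ i < len d, ∀ t ∈ Set.Ico (0 : ℝ) 1, ¬ (i = 0 ∧ t = 0) →
    ∀ x, AffineMap.lineMap (pt d i) (pt d (i + 1)) t ≠ pos x
  inner_injective : ∀ d d', ∀ i < len d, ∀ i' < len d',
    ∀ t ∈ Set.Ico (0 : ℝ) 1, ∀ t' ∈ Set.Ico (0 : ℝ) 1,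
    ¬ (i = 0 ∧ t = 0) → ¬ (i' = 0 ∧ t' = 0) →
    AffineMap.lineMap (pt d i) (pt d (i + 1)) t = AffineMap.lineMap (pt d' i') (pt d' (i' + 1)) t' →
    (d' = d ∧ i' = i ∧ t' = t) ∨ d' = inv d
  /-- Turning counterclockwise around `tail d`, starting at `d`, the first dart met is `rot d`. -/
  rot_ccw : ∀ d d', tail d' = tail d →
    ccwAngle (pt d 1 - pt d 0) (pt (rot d) 1 - pt (rot d) 0) ≤
      ccwAngle (pt d 1 - pt d 0) (pt d' 1 - pt d' 0)

/-! Write `⟨a, b⟩` for the sum of `a d * b d` over darts. By `exists_dirichletHarmonic_of_flow` it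
suffices to find a flow of finite energy in `G` and a gradient of finite energy with non-zero
pairing: the projection of the gradient onto the orthogonal complement of the vertex stars is again
a gradient, is harmonic, and has the same pairing with the flow.

Let `η` be `h` on the common edges; its pairing with `f` there is non-zero, as one edge contributes.
If `η` is orthogonal to all finite flows, it is a gradient (`exists_potential_of_orthogonal_flows`),
and `f` with its roundabouts contracted is the required flow.

Otherwise some finite flow `z` has `⟨z, η⟩ ≠ 0`. The roundabout arcs of the dual are the corners of
the drawing, so pushing `h` through the corners gives a flow `g` in `G` (`isFlow_reroute`). By
planarity `z` is the boundary of a face function `s` (`exists_face_function`). Away from `z`, `s` is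
constant around each vertex and so defines a vertex function `u`; its gradient has finite support,
and summation by parts gives `⟨g, du⟩ = -⟨z, η⟩ ≠ 0`.

The face function is a winding number, computed as a weighted sum of the angles under which the
edges are seen. `symArg` is antisymmetric under inversion, so that a point on an edge gets the mean
of the values on its two sides. -/

namespace Multigraph

/-! ### Flows, gradients and the Hilbert space argument -/

variable {V D : Type*} {G : Multigraph V D}

theorem inv_inv (G : Multigraph V D) (d : D) : G.inv (G.inv d) = d := G.inv_involutive d

def invEquiv (G : Multigraph V D) : Equiv.Perm D := G.inv_involutive.toPerm

@[simp] theorem invEquiv_apply (G : Multigraph V D) (d : D) : G.invEquiv d = G.inv d := rfl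

open Classical in
theorem finsum_star_eq_tsum (hG : G.LocallyFinite) (x : V) (f : D → ℝ) :
    ∑ᶠ d ∈ G.star x, f d = ∑' d, if G.tail d = x then f d else 0 := by
  rw [finsum_mem_eq_finite_toFinset_sum _ (hG x), tsum_eq_sum (s := (hG x).toFinset)]
  · refine Finset.sum_congr rfl fun d hd => ?_
    rw [if_pos]
    simpa [star] using hd
  · intro d hd
    rw [if_neg]
    simpa [star] using hd

theorem summable_mul_of_finite_support {z : D → ℝ} (hz : z.support.Finite) (F : D → ℝ) :
    Summable fun d => z d * F d :=
  summable_of_hasFiniteSupport (hz.subset fun d hd => by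
    simp only [Function.mem_support] at hd ⊢
    exact left_ne_zero_of_mul hd)

/-- A finitely supported flow is orthogonal to every function of the tails. -/
theorem IsFlow.tsum_mul_tail_eq_zero (hG : G.LocallyFinite) {z : D → ℝ} (hz : G.IsFlow z)
    (hfin : z.support.Finite) (τ : V → ℝ) : ∑' d, z d * τ (G.tail d) = 0 := by
  classical
  rw [tsum_eq_sum (s := hfin.toFinset) (by
    intro d hd
    have : z d = 0 := by simpa using hd
    simp [this])]
  rw [← Finset.sum_fiberwise_of_maps_to (t := hfin.toFinset.image G.tail) (g := G.tail)
    (fun d hd => Finset.mem_image_of_mem _ hd)]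
  refine Finset.sum_eq_zero fun x _ => ?_
  have hk := hz.kirchhoff x
  rw [finsum_star_eq_tsum hG, tsum_eq_sum (s := hfin.toFinset) (by
    intro d hd
    have : z d = 0 := by simpa using hd
    simp [this]), ← Finset.sum_filter] at hk
  have : ∀ d ∈ hfin.toFinset.filter (fun d => G.tail d = x),
      z d * τ (G.tail d) = z d * τ x := by
    intro d hd
    rw [(Finset.mem_filter.1 hd).2]
  rw [Finset.sum_congr rfl this, ← Finset.sum_mul, hk, zero_mul]

theorem IsFlow.tsum_mul_head_sub_tail (hG : G.LocallyFinite) {z : D → ℝ} (hz : G.IsFlow z)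
    (hfin : z.support.Finite) (τ : V → ℝ) :
    ∑' d, z d * (τ (G.head d) - τ (G.tail d)) = 0 := by
  have h1 := hz.tsum_mul_tail_eq_zero hG hfin τ
  have h2 : ∑' d, z d * τ (G.head d) = 0 := by
    rw [← G.invEquiv.tsum_eq]
    simp only [invEquiv_apply, hz.antisymm, head, inv_inv, neg_mul, tsum_neg, h1, neg_zero]
  simp only [mul_sub]
  rw [(summable_mul_of_finite_support hfin _).tsum_sub (summable_mul_of_finite_support hfin _),
    h1, h2, sub_zero]

/-- An antisymmetric function orthogonal to all finitely supported flows is a gradient. -/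
theorem exists_potential_of_orthogonal_flows (hG : G.LocallyFinite) {r : D → ℝ}
    (hr : ∀ d, r (G.inv d) = - r d)
    (horth : ∀ z : D → ℝ, z.support.Finite → G.IsFlow z → ∑' d, z d * r d = 0) :
    ∃ u : V → ℝ, ∀ d, r d = u (G.head d) - u (G.tail d) := by
  classical
  let bd : (D →₀ ℝ) →ₗ[ℝ] (V →₀ ℝ) := Finsupp.linearCombination ℝ fun d =>
    Finsupp.single (G.head d) 1 - Finsupp.single (G.tail d) 1
  let R : (D →₀ ℝ) →ₗ[ℝ] ℝ := Finsupp.linearCombination ℝ r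
  -- The antisymmetrisation of a chain without boundary is a finite flow, and its pairing with `r`
  -- is twice `R w`.
  have hker : LinearMap.ker bd ≤ LinearMap.ker R := by
    intro w hw
    rw [LinearMap.mem_ker] at hw ⊢
    have hwi : (fun d => w (G.inv d)).support.Finite :=
      (w.hasFiniteSupport.preimage G.inv_involutive.injective.injOn)
    have hwf : (Function.support w).Finite := w.hasFiniteSupport
    have hfin : (fun d => w d - w (G.inv d)).support.Finite := 
      (hwf.union hwi).subset (Function.support_sub _ _)
    have hsum : ∀ F : D → ℝ, ∑' d, (w d - w (G.inv d)) * F d =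
        ∑' d, w d * (F d - F (G.inv d)) := by
      intro F
      simp only [sub_mul, mul_sub]
      rw [(summable_mul_of_finite_support hwf _).tsum_sub (summable_mul_of_finite_support hwi _),
        (summable_mul_of_finite_support hwf _).tsum_sub (summable_mul_of_finite_support hwf _),
        ← G.invEquiv.tsum_eq (fun d => w (G.inv d) * F d)]
      simp only [invEquiv_apply, inv_inv]
    have hlin : ∀ F : D → ℝ, ∑' d, w d * F d = Finsupp.linearCombination ℝ F w := by
      intro F
      rw [Finsupp.linearCombination_apply, Finsupp.sum, tsum_eq_sum (s := w.support)]
      · rfl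
      · intro d hd
        simp [Finsupp.notMem_support_iff.1 hd]
    have key := horth _ hfin ⟨fun d => by rw [inv_inv]; ring, fun x => by
      rw [finsum_star_eq_tsum hG]
      have h1 := hsum fun d => if G.tail d = x then 1 else 0
      simp only [mul_ite, mul_one, mul_zero] at h1
      rw [h1, hlin]
      have h2 := congrArg (fun v => - v x) hw
      simp only [bd, Finsupp.linearCombination_apply, Finsupp.sum, Finsupp.finsetSum_apply,
        Finsupp.coe_zero, Pi.zero_apply, neg_zero, ← Finset.sum_neg_distrib] at h2
      rw [Finsupp.linearCombination_apply, Finsupp.sum]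
      refine Eq.trans (Finset.sum_congr rfl fun d _ => ?_) h2
      simp only [Finsupp.smul_apply, Finsupp.sub_apply, Finsupp.single_apply, head, smul_eq_mul]
      ring⟩
    rw [hsum, hlin] at key
    have h3 : (fun d => r d - r (G.inv d)) = fun d => (2 : ℝ) * r d := by
      funext d; rw [hr]; ring
    rw [h3] at key
    have h4 : Finsupp.linearCombination ℝ (fun d => (2 : ℝ) * r d) w = 2 * R w := by
      simp only [R, Finsupp.linearCombination_apply, Finsupp.sum, Finset.mul_sum, smul_eq_mul]
      exact Finset.sum_congr rfl fun d _ => by ring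
    rw [h4] at key
    simpa using key
  -- `R` factors through the image of `bd`; a linear left inverse extends the factor to all of `V →₀
  -- ℝ`, and its values on the basis are the potential.
  obtain ⟨φ, hφ⟩ : ∃ φ : (V →₀ ℝ) →ₗ[ℝ] ℝ, φ ∘ₗ bd = R := by
    obtain ⟨g, hg⟩ := (LinearMap.exists_leftInverse_of_injective
      ((LinearMap.ker bd).liftQ bd le_rfl) (Submodule.ker_liftQ_eq_bot _ _ _ le_rfl))
    refine ⟨(LinearMap.ker bd).liftQ R hker ∘ₗ g, ?_⟩
    ext w
    have := LinearMap.congr_fun hg (Submodule.Quotient.mk (Finsupp.single w 1))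
    simp at this ⊢
    rw [this]
    simp
  refine ⟨fun x => φ (Finsupp.single x 1), fun d => ?_⟩
  have := LinearMap.congr_fun hφ (Finsupp.single d 1)
  simp only [R, bd, LinearMap.comp_apply, Finsupp.linearCombination_single, one_smul,
    map_sub] at this
  exact this.symm

/-- `r` is the projection of `v`; it exists because `Sᗮ` is closed, whether or not `S` is. -/
theorem exists_mem_orthogonal_inner_eq {E : Type*} [NormedAddCommGroup E] [InnerProductSpace ℝ E]
    [CompleteSpace E] (S : Submodule ℝ E) (v : E) :
    ∃ r ∈ Sᗮ, ∀ w ∈ Sᗮ, inner ℝ w r = inner ℝ w v := by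
  obtain ⟨r, hr, k, hk, hkr⟩ := (Sᗮ).exists_add_mem_mem_orthogonal v
  refine ⟨r, hr, fun w hw => ?_⟩
  rw [hkr, inner_add_right, (Submodule.mem_orthogonal _ _).1 hk w hw, add_zero]

/-- A flow of finite energy that is not orthogonal to a gradient of finite energy witnesses a
non-constant Dirichlet harmonic function. -/
theorem exists_dirichletHarmonic_of_flow (hG : G.LocallyFinite) {g : D → ℝ} (hg : G.IsFlow g)
    (hgE : FiniteEnergy g) (u₀ : V → ℝ)
    (hu₀ : FiniteEnergy fun d => u₀ (G.head d) - u₀ (G.tail d))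
    (hne : ∑' d, g d * (u₀ (G.head d) - u₀ (G.tail d)) ≠ 0) :
    ∃ u : V → ℝ, G.IsDirichletHarmonic u ∧ ∃ x y, u x ≠ u y := by
  classical
  have mem : ∀ F : D → ℝ, FiniteEnergy F → Memℓp F 2 := fun F hF =>
    memℓp_gen (by simpa [FiniteEnergy] using hF)
  let H := lp (fun _ : D => ℝ) 2
  let gv : H := ⟨g, mem g hgE⟩
  let uv : H := ⟨fun d => u₀ (G.head d) - u₀ (G.tail d), mem _ hu₀⟩
  let e : D → H := fun d => lp.single 2 d (1 : ℝ)
  have he : ∀ d (v : H), inner ℝ (e d) v = v d := by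
    intro d v
    rw [lp.inner_single_left]
    simp
  let st : V → H := fun x => ∑ d ∈ (hG x).toFinset, (e d - e (G.inv d))
  have hst : ∀ x (v : H), (∀ d, v (G.inv d) = - v d) →
      inner ℝ (st x) v = 2 * ∑ᶠ d ∈ G.star x, v d := by
    intro x v hv
    rw [finsum_mem_eq_finite_toFinset_sum _ (hG x), sum_inner, Finset.mul_sum]
    refine Finset.sum_congr rfl fun d _ => ?_
    rw [inner_sub_left, he, he, hv]
    ring
  let S : Submodule ℝ H := Submodule.span ℝ (Set.range st)
  have hSorth : ∀ v : H, (∀ x, inner ℝ (st x) v = 0) → v ∈ Sᗮ := by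
    intro v hv
    rw [Submodule.mem_orthogonal]
    intro w hw
    induction hw using Submodule.span_induction with
    | mem w hw => obtain ⟨x, rfl⟩ := hw; exact hv x
    | zero => simp
    | add a b _ _ ha hb => rw [inner_add_left, ha, hb, add_zero]
    | smul c a _ ha => rw [inner_smul_left, ha, mul_zero]
  have hflow : ∀ v : H, G.IsFlow v → v ∈ Sᗮ := fun v hv =>
    hSorth v fun x => by rw [hst x v hv.antisymm, hv.kirchhoff, mul_zero]
  obtain ⟨r, hr', hgk⟩ := exists_mem_orthogonal_inner_eq S uv
  have hrr : ∀ d, r (G.inv d) = - r d := by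
    intro d
    -- The stars are antisymmetric, hence orthogonal to symmetric vectors. Testing against these
    -- shows that the projection stays antisymmetric.
    have h1 : e d + e (G.inv d) ∈ Sᗮ := by
      refine hSorth _ fun x => ?_
      have hee : ∀ a b, inner ℝ (e a) (e b) = if a = b then (1 : ℝ) else 0 := by
        intro a b
        rw [he, lp.coeFn_single, Pi.single_apply]
      have hiff : ∀ a b, G.inv a = b ↔ a = G.inv b := fun a b => G.inv_involutive.eq_iff
      rw [sum_inner]
      refine Finset.sum_eq_zero fun a _ => ?_
      simp only [inner_sub_left, inner_add_right, hee, hiff, inv_inv]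
      ring
    have h2 := hgk _ h1
    rw [inner_add_left, inner_add_left, he, he, he, he] at h2
    have h3 : uv d + uv (G.inv d) = 0 := by
      simp [uv, head, inv_inv]
    linarith
  have hrorth : ∀ z : D → ℝ, z.support.Finite → G.IsFlow z → ∑' d, z d * r d = 0 := by
    intro z hfin hz
    have hzE : FiniteEnergy z := by
      have := summable_mul_of_finite_support hfin z
      simpa [FiniteEnergy, sq] using this
    have h1 := hgk ⟨z, mem z hzE⟩ (hflow _ hz)
    rw [lp.inner_eq_tsum, lp.inner_eq_tsum] at h1
    have h2 := hz.tsum_mul_head_sub_tail hG hfin u₀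
    simp only [RCLike.inner_apply, conj_trivial, uv, mul_comm] at h1 h2 ⊢
    rw [h1, h2]
  obtain ⟨u, hu⟩ := exists_potential_of_orthogonal_flows hG hrr hrorth
  refine ⟨u, ⟨fun x => ?_, ?_⟩, ?_⟩
  · have h1 := hst x r hrr
    rw [(Submodule.mem_orthogonal _ _).1 hr' _ (Submodule.subset_span ⟨x, rfl⟩)] at h1
    have h2 : ∑ᶠ d ∈ G.star x, r d = 0 := by linarith
    rw [finsum_mem_eq_finite_toFinset_sum _ (hG x)] at h2 ⊢
    have h3 : ∀ d ∈ (hG x).toFinset, r d = u (G.head d) - u x := by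
      intro d hd
      have : G.tail d = x := by simpa [star] using hd
      rw [hu, this]
    rw [Finset.sum_congr rfl h3, Finset.sum_sub_distrib, Finset.sum_const, nsmul_eq_mul] at h2
    rw [Set.ncard_eq_toFinset_card _ (hG x)]
    linarith
  · have h1 := (lp.memℓp r).summable (by norm_num)
    refine h1.congr fun d => ?_
    rw [hu]
    simp only [ENNReal.toReal_ofNat, Real.rpow_ofNat, Real.norm_eq_abs, sq_abs]
    ring
  -- For constant `u` the projection `r` vanishes, which would make `g` orthogonal to the gradient
  -- of `u₀`.
  · by_contra! hcon
    have h1 := hgk gv (hflow gv hg)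
    rw [lp.inner_eq_tsum, lp.inner_eq_tsum] at h1
    apply hne
    simp only [RCLike.inner_apply, conj_trivial, uv, gv] at h1
    simp only [mul_comm (g _)]
    rw [← h1]
    simp [hu, fun d => hcon (G.head d) (G.tail d)]

end Multigraph

/-! ### Roundabouts, rerouting through corners, and the case distinction -/

namespace RotationSystem

variable {V D : Type*} {G : RotationSystem V D}

theorem tail_rot (G : RotationSystem V D) (d : D) : G.tail (G.rot d) = G.tail d :=
  ((G.sameCycle_iff d (G.rot d)).1 (Equiv.Perm.SameCycle.refl _ _).apply_right).symm

theorem facePerm_inv_rot (G : RotationSystem V D) (d : D) :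
    G.facePerm (G.inv (G.rot d)) = d := by
  simp [facePerm, G.inv_involutive _]

/-- Summation by parts around a vertex: rotational differences add up to zero. -/
theorem finsum_star_rot_sub (hG : G.LocallyFinite) (K : D → ℝ) (x : V) :
    ∑ᶠ d ∈ G.star x, (K (G.rot d) - K d) = 0 := by
  rw [finsum_mem_eq_finite_toFinset_sum _ (hG x), Finset.sum_sub_distrib, sub_eq_zero]
  refine Finset.sum_equiv G.rot (fun d => ?_) fun _ _ => rfl
  simp [Multigraph.star, tail_rot]

theorem roundabout_kirchhoff {f : RoundaboutDart D → ℝ} (hf : G.roundabout.IsFlow f) (d : D) :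
    f (.edge d) + f (.fwd d) - f (.fwd (G.rot.symm d)) = 0 := by
  have hstar : G.roundabout.star d =
      {RoundaboutDart.edge d, RoundaboutDart.fwd d, RoundaboutDart.bwd (G.rot.symm d)} := by
    ext e
    rcases e with e | e | e <;>
      simp [Multigraph.star, roundabout, Equiv.eq_symm_apply]
  have h1 := hf.kirchhoff d
  rw [hstar, finsum_mem_insert _ (by simp) (Set.toFinite _), finsum_mem_insert _ (by simp)
    (Set.toFinite _), finsum_mem_singleton] at h1
  have h2 := hf.antisymm (RoundaboutDart.fwd (G.rot.symm d))
  have h3 : G.roundabout.inv (RoundaboutDart.fwd (G.rot.symm d)) =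
    RoundaboutDart.bwd (G.rot.symm d) := rfl
  rw [h3] at h2
  linarith

/-- Contracting the roundabouts turns a flow of the roundabout graph into a flow of the graph. -/
theorem isFlow_edge (hG : G.LocallyFinite) {f : RoundaboutDart D → ℝ}
    (hf : G.roundabout.IsFlow f) : G.IsFlow fun d => f (.edge d) where
  antisymm d := hf.antisymm (.edge d)
  kirchhoff x := by
    have h := finsum_star_rot_sub hG (fun d => - f (.fwd (G.rot.symm d))) x
    rw [← h]
    refine finsum_mem_congr rfl fun d _ => ?_
    have := roundabout_kirchhoff hf d
    simp only [Equiv.symm_apply_apply]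
    linarith

theorem finiteEnergy_comp {E : Type*} {f : E → ℝ} (hf : FiniteEnergy f) {i : D → E}
    (hi : Function.Injective i) : FiniteEnergy fun d => f (i d) :=
  hf.comp_injective hi

theorem finiteEnergy_add {f g : D → ℝ} (hf : FiniteEnergy f) (hg : FiniteEnergy g) :
    FiniteEnergy fun d => f d + g d := by
  refine Summable.of_nonneg_of_le (fun _ => sq_nonneg _) (fun d => ?_)
    ((hf.mul_left 2).add (hg.mul_left 2))
  nlinarith [sq_nonneg (f d - g d)]

theorem finiteEnergy_neg {f : D → ℝ} (hf : FiniteEnergy f) :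
    FiniteEnergy fun d => - f d := by
  simpa [FiniteEnergy] using hf

/-- Rerouting a flow in the roundabout graph of the dual, and contracting the roundabouts, gives a
flow in the graph. -/
theorem isFlow_reroute (hG : G.LocallyFinite) {h : RoundaboutDart D → ℝ}
    (hh : G.dual.roundabout.IsFlow h) :
    (∀ d, h (.edge d) + (h (.fwd d) - h (.fwd (G.inv d))) =
      h (.fwd (G.inv (G.rot d))) - h (.fwd (G.inv d))) ∧
    G.IsFlow fun d => h (.edge d) + (h (.fwd d) - h (.fwd (G.inv d))) := by
  -- `h (.fwd (G.inv d))` is the flow through the corner between `rot⁻¹ d` and `d`, so the new flow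
  -- is a difference over the two corners next to `d` at its tail.
  have hK : ∀ d, h (.edge d) + (h (.fwd d) - h (.fwd (G.inv d))) =
      h (.fwd (G.inv (G.rot d))) - h (.fwd (G.inv d)) := by
    intro d
    have h1 := roundabout_kirchhoff hh d
    have h2 : G.dual.rot.symm d = G.inv (G.rot d) := by
      rw [Equiv.symm_apply_eq]
      exact (G.facePerm_inv_rot d).symm
    rw [h2] at h1
    linarith
  refine ⟨hK, fun d => ?_, fun x => ?_⟩
  · have h1 : h (.edge (G.inv d)) = - h (.edge d) := hh.antisymm (.edge d)
    rw [h1, G.inv_inv]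
    ring
  · simp only [hK]
    exact finsum_star_rot_sub hG (fun d => h (.fwd (G.inv d))) x

/-- If finite flows are boundaries of functions on the faces, then two flows of finite energy in
the roundabout graphs of `G` and its dual that are not orthogonal on the common edges
witness a non-constant Dirichlet harmonic function. -/
theorem exists_dirichletHarmonic (hG : G.LocallyFinite)
    (hcut : ∀ z : D → ℝ, z.support.Finite → G.IsFlow z → ∃ s : D → ℝ,
      (∀ d, s (G.facePerm d) = s d) ∧ ∀ d, s d - s (G.inv d) = z d)
    {f h : RoundaboutDart D → ℝ}
    (hf : G.roundabout.IsFlow f) (hfE : FiniteEnergy f)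
    (hh : G.dual.roundabout.IsFlow h) (hhE : FiniteEnergy h)
    (hne : ∑' d, f (.edge d) * h (.edge d) ≠ 0) :
    ∃ u : V → ℝ, G.IsDirichletHarmonic u ∧ ∃ x y, u x ≠ u y := by
  classical
  have einj : Function.Injective (RoundaboutDart.edge : D → _) := fun _ _ => by simp
  have finj : Function.Injective (RoundaboutDart.fwd : D → _) := fun _ _ => by simp
  have hηE := finiteEnergy_comp hhE einj
  have hanti : ∀ d, h (.edge (G.inv d)) = - h (.edge d) := fun d => hh.antisymm (.edge d)
  by_cases hex : ∀ z : D → ℝ, z.support.Finite → G.IsFlow z → ∑' d, z d * h (.edge d) = 0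
  · obtain ⟨u, hu⟩ := Multigraph.exists_potential_of_orthogonal_flows hG hanti hex
    refine Multigraph.exists_dirichletHarmonic_of_flow hG (isFlow_edge hG hf)
      (finiteEnergy_comp hfE einj) u ?_ ?_
    · simpa only [← hu] using hηE
    · simpa only [← hu] using hne
  push Not at hex
  obtain ⟨z, hfin, hz, hzne⟩ := hex
  obtain ⟨s, hsface, hs⟩ := hcut z hfin hz
  have hsrot : ∀ d, s (G.rot d) = s d + z (G.rot d) := by
    intro d
    have h1 := hsface (G.inv (G.rot d))
    rw [facePerm_inv_rot] at h1
    rw [← hs (G.rot d), h1]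
    ring
  obtain ⟨hgK, hgflow⟩ := isFlow_reroute hG hh
  set g : D → ℝ := fun d => h (.edge d) + (h (.fwd d) - h (.fwd (G.inv d))) with hgdef
  have hgE : FiniteEnergy g := finiteEnergy_add hηE (finiteEnergy_add (finiteEnergy_comp hhE finj)
    (finiteEnergy_neg (finiteEnergy_comp hhE (finj.comp G.inv_involutive.injective))))
  let K : D → ℝ := fun d => h (.fwd (G.inv d))
  have hgK' : ∀ d, g d = K (G.rot d) - K d := hgK
  let T : Set V := G.tail '' z.support
  have hT : T.Finite := hfin.image _
  -- Off `T` all corners at `x` carry the same value of `s`. The default `0` is harmless: `T` meets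
  -- finitely many darts, and isolated vertices meet none.
  let u : V → ℝ := fun x => if hx : x ∉ T ∧ ∃ d, G.tail d = x then s hx.2.choose else 0
  have hsconst : ∀ x, x ∉ T → ∀ d d', G.tail d = x → G.tail d' = x → s d = s d' := by
    intro x hx d d' hd hd'
    have hz0 : ∀ e, G.tail e = x → z e = 0 := by
      intro e he
      by_contra hne
      exact hx ⟨e, hne, he⟩
    obtain ⟨n, rfl⟩ := (G.sameCycle_iff d d').2 (hd.trans hd'.symm)
    have step : ∀ e, G.tail e = x → s (G.rot e) = s e := fun e he => by
      rw [hsrot, hz0 _ ((G.tail_rot e).trans he), add_zero]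
    have htz : ∀ m : ℤ, G.tail ((G.rot ^ m) d) = x := fun m =>
      ((G.sameCycle_iff d _).1 ⟨m, rfl⟩).symm.trans hd
    have hstep : ∀ m : ℤ, s ((G.rot ^ (m + 1)) d) = s ((G.rot ^ m) d) := fun m => by
      rw [add_comm, zpow_add, zpow_one, Equiv.Perm.mul_apply, step _ (htz m)]
    clear hd'
    induction n with
    | zero => simp
    | succ m ih => rw [ih, hstep]
    | pred m ih => rw [ih, ← hstep (-m - 1), sub_add_cancel]
  have hW : ∀ d, G.tail d ∉ T → u (G.tail d) = s d := by
    intro d hd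
    have hx : G.tail d ∉ T ∧ ∃ d', G.tail d' = G.tail d := ⟨hd, d, rfl⟩
    simp only [u, dif_pos hx]
    exact hsconst _ hd _ _ hx.2.choose_spec rfl
  let W : D → ℝ := fun d => u (G.tail d) - s d
  have hWfin : W.support.Finite := by
    refine (hT.biUnion fun x _ => hG x).subset fun d hd => ?_
    simp only [Set.mem_iUnion]
    refine ⟨G.tail d, ?_, rfl⟩
    by_contra hcon
    exact hd (by simp [W, hW d hcon])
  have hdu : ∀ d, u (G.head d) - u (G.tail d) = W (G.inv d) - W d - z d := by
    intro d
    rw [← hs]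
    simp only [W, Multigraph.head]
    ring
  have hWifin : (fun d => W (G.inv d)).support.Finite :=
    hWfin.preimage G.inv_involutive.injective.injOn
  have hWrfin : (fun d => W (G.rot d)).support.Finite :=
    hWfin.preimage G.rot.injective.injOn
  have summ : ∀ {w : D → ℝ}, w.support.Finite → ∀ F : D → ℝ, Summable fun d => w d * F d :=
    fun hw F => Multigraph.summable_mul_of_finite_support hw F
  have hdufin : (fun d => u (G.head d) - u (G.tail d)).support.Finite := by
    refine ((hWifin.union hWfin).union hfin).subset fun d hd => ?_
    by_contra hcon
    simp only [Set.mem_union, Function.mem_support, not_or, not_not] at hcon hd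
    exact hd (by rw [hdu, hcon.1.1, hcon.1.2, hcon.2]; ring)
  refine Multigraph.exists_dirichletHarmonic_of_flow hG hgflow hgE u ?_ ?_
  · have := summ hdufin fun d => u (G.head d) - u (G.tail d)
    simpa [FiniteEnergy, sq] using this
  have e1 : ∑' d, W (G.inv d) * g d = - ∑' d, W d * g d := by
    rw [← G.invEquiv.tsum_eq, ← tsum_neg]
    refine tsum_congr fun d => ?_
    rw [G.invEquiv_apply, G.inv_inv, hgflow.antisymm]
    ring
  -- Summation by parts around the vertices: `u` is constant along a rotation, so `W` changes by `-z
  -- (rot d)` from `d` to `rot d`.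
  have e2 : ∑' d, W d * g d = ∑' d, z d * K d := by
    have a1 : ∑' d, W d * g d = ∑' d, W d * K (G.rot d) - ∑' d, W d * K d := by
      rw [← (summ hWfin _).tsum_sub (summ hWfin _)]
      exact tsum_congr fun d => by rw [hgK']; ring
    rw [a1, ← G.rot.tsum_eq (fun d => W d * K d), ← G.rot.tsum_eq (fun d => z d * K d),
      ← (summ hWfin _).tsum_sub (summ hWrfin _)]
    refine tsum_congr fun d => ?_
    simp only [W, tail_rot, hsrot]
    ring
  have e3 : ∑' d, z d * g d = ∑' d, z d * h (.edge d) - 2 * ∑' d, z d * K d := by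
    have a1 : ∑' d, z d * K (G.inv d) = - ∑' d, z d * K d := by
      rw [← G.invEquiv.tsum_eq, ← tsum_neg]
      refine tsum_congr fun d => ?_
      rw [G.invEquiv_apply, G.inv_inv, hz.antisymm]
      ring
    have a2 : ∑' d, z d * g d = ∑' d, z d * h (.edge d) +
        (∑' d, z d * K (G.inv d) - ∑' d, z d * K d) := by
      rw [← (summ hfin _).tsum_sub (summ hfin _), ← (summ hfin _).tsum_add
        ((summ hfin _).sub (summ hfin _))]
      refine tsum_congr fun d => ?_
      simp only [hgdef, K, G.inv_inv]
      ring
    rw [a2, a1]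
    ring
  -- The corner terms `⟨z, K⟩` from `e2` and `e3` cancel.
  have e4 : ∑' d, g d * (u (G.head d) - u (G.tail d)) = - ∑' d, z d * h (.edge d) := by
    have a1 : ∑' d, g d * (u (G.head d) - u (G.tail d)) =
        ∑' d, W (G.inv d) * g d - ∑' d, W d * g d - ∑' d, z d * g d := by
      rw [← (summ hWifin _).tsum_sub (summ hWfin _), ← ((summ hWifin _).sub
        (summ hWfin _)).tsum_sub (summ hfin _)]
      exact tsum_congr fun d => by rw [hdu]; ring
    rw [a1, e1, e2, e3]
    ring
  rw [e4]
  exact neg_ne_zero.2 hzne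

end RotationSystem

/-! ### A symmetric branch of the argument and the angles of segments -/

/-- The argument, with the value `π` on the negative real axis replaced by `0`. -/
noncomputable def symArg (x : ℂ) : ℝ := if x.arg = Real.pi then 0 else x.arg

section symArg

open Complex

theorem symArg_of_mem_slitPlane {x : ℂ} (hx : x ∈ slitPlane) : symArg x = x.arg :=
  if_neg (mem_slitPlane_iff_arg.1 hx).1

@[simp] theorem symArg_zero : symArg 0 = 0 := by simp [symArg]

theorem symArg_ofReal (r : ℝ) : symArg r = 0 := by
  rcases le_or_gt 0 r with h | h
  · simp [symArg, arg_ofReal_of_nonneg h]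
  · simp [symArg, arg_ofReal_of_neg h]

theorem symArg_inv (x : ℂ) : symArg x⁻¹ = - symArg x := by
  unfold symArg
  rw [arg_inv]
  by_cases h : x.arg = Real.pi
  · simp [h]
  · have h2 : ¬ - x.arg = Real.pi := fun h' => by
      have := neg_pi_lt_arg x
      linarith
    simp [h, h2]

theorem symArg_div_comm (x y : ℂ) : symArg (x / y) = - symArg (y / x) := by
  rw [← symArg_inv, inv_div]

theorem symArg_real_mul {r : ℝ} (hr : 0 < r) (x : ℂ) : symArg (r * x) = symArg x := by
  simp only [symArg, arg_real_mul x hr]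

/-- A continuous function whose values are multiples of a full turn is constant. -/
theorem eq_zero_of_continuousOn_of_coe_angle_eq_zero {F : ℝ → ℝ}
    (hF : ContinuousOn F (Set.Icc 0 1)) (h0 : F 0 = 0)
    (hang : ∀ t ∈ Set.Icc (0 : ℝ) 1, (F t : Real.Angle) = 0) : F 1 = 0 := by
  have hpi := Real.pi_pos
  have hcoe : ∀ t ∈ Set.Icc (0 : ℝ) 1, ∃ n : ℤ, F t = n * (2 * Real.pi) := by
    intro t ht
    obtain ⟨n, hn⟩ := Real.Angle.coe_eq_zero_iff.1 (hang t ht)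
    exact ⟨n, by rw [← hn, zsmul_eq_mul]⟩
  have hodd : ∀ c : ℝ, c = Real.pi ∨ c = - Real.pi → ∀ n : ℤ, c ≠ n * (2 * Real.pi) := by
    rintro c (rfl | rfl) n hn
    · have h1 : (1 : ℝ) = 2 * n := by
        apply mul_right_cancel₀ hpi.ne'
        linarith
      have h2 : (1 : ℤ) = 2 * n := by exact_mod_cast h1
      omega
    · have h1 : (-1 : ℝ) = 2 * n := by
        apply mul_right_cancel₀ hpi.ne'
        linarith
      have h2 : (-1 : ℤ) = 2 * n := by exact_mod_cast h1
      omega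
  obtain ⟨n, hn⟩ := hcoe 1 (by simp)
  rcases lt_trichotomy n 0 with hlt | rfl | hgt
  · have h1 : (n : ℝ) ≤ -1 := by exact_mod_cast Int.le_sub_one_of_lt hlt
    have h2 : - Real.pi ∈ Set.Icc (F 1) (F 0) := by
      rw [h0, hn]
      constructor <;> nlinarith
    obtain ⟨t, ht, hFt⟩ := intermediate_value_Icc' zero_le_one hF h2
    obtain ⟨m, hm⟩ := hcoe t ht
    exact absurd (hFt.symm.trans hm) (hodd _ (Or.inr rfl) m)
  · simpa using hn
  · have h1 : (1 : ℝ) ≤ n := by exact_mod_cast hgt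
    have h2 : Real.pi ∈ Set.Icc (F 0) (F 1) := by
      rw [h0, hn]
      constructor <;> nlinarith
    obtain ⟨t, ht, hFt⟩ := intermediate_value_Icc zero_le_one hF h2
    obtain ⟨m, hm⟩ := hcoe t ht
    exact absurd (hFt.symm.trans hm) (hodd _ (Or.inl rfl) m)

theorem div_mem_slitPlane {x y : ℂ} (hy : y ≠ 0)
    (h : ∀ r : ℝ, 0 ≤ r → x ≠ - (r : ℂ) * y) : x / y ∈ slitPlane := by
  rw [mem_slitPlane_iff_not_le_zero]
  intro hle
  obtain ⟨hre, him⟩ := le_def.1 hle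
  apply h (-(x / y).re) (by simpa using hre)
  have : x / y = ((x / y).re : ℂ) := by
    apply Complex.ext <;> simp
    simpa using him
  rw [ofReal_neg, neg_neg, ← this, div_mul_cancel₀ _ hy]

/-- A quotient on the closed negative real ray would place `q` between `a` and `b`. -/
theorem sub_div_sub_mem_slitPlane {a b q : ℂ} (h : q ∉ segment ℝ a b) :
    (b - q) / (a - q) ∈ slitPlane := by
  refine div_mem_slitPlane ?_ fun r hr hx => h ?_
  · rintro h0
    rw [sub_eq_zero] at h0
    exact h (h0 ▸ left_mem_segment ℝ a b)
  · have hr' : (1 + r : ℝ) ≠ 0 := by positivity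
    have hc : (1 + r : ℂ) ≠ 0 := by exact_mod_cast hr'
    refine ⟨r / (1 + r), 1 / (1 + r), by positivity, by positivity, ?_, ?_⟩
    · field_simp
      ring
    · simp only [real_smul]
      push_cast
      field_simp
      linear_combination hx

theorem lineMap_eq (p q : ℂ) (t : ℝ) : AffineMap.lineMap p q t = p + t * (q - p) := by
  rw [AffineMap.lineMap_apply, vsub_eq_sub, vadd_eq_add, real_smul, add_comm]

/-- If two segments are disjoint, then the change of the angle under which the first is seen while
moving along the second is the difference of the angles under which the second is seen from the
ends of the first. -/
theorem symArg_sub_symArg_of_disjoint {a b p q : ℂ}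
    (h : Disjoint (segment ℝ a b) (segment ℝ p q)) :
    symArg ((b - q) / (a - q)) - symArg ((b - p) / (a - p)) =
      symArg ((b - q) / (b - p)) - symArg ((a - q) / (a - p)) := by
  let c : ℝ → ℂ := fun t => p + t * (q - p)
  have hc : ∀ t ∈ Set.Icc (0 : ℝ) 1, c t ∈ segment ℝ p q := by
    intro t ht
    rw [segment_eq_image_lineMap]
    exact ⟨t, ht, lineMap_eq p q t⟩
  have hab : ∀ t ∈ Set.Icc (0 : ℝ) 1, c t ∉ segment ℝ a b := fun t ht hmem =>
    Set.disjoint_left.1 h hmem (hc t ht)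
  have hsub : ∀ x ∈ segment ℝ a b, ∀ t ∈ Set.Icc (0 : ℝ) 1, x ∉ segment ℝ p (c t) :=
    fun x hx t ht hmem => Set.disjoint_left.1 h hx
      ((convex_segment p q).segment_subset (left_mem_segment ℝ p q) (hc t ht) hmem)
  have ha : a ∈ segment ℝ a b := left_mem_segment ℝ a b
  have hb : b ∈ segment ℝ a b := right_mem_segment ℝ a b
  have hslit2 : ∀ x ∈ segment ℝ a b, ∀ t ∈ Set.Icc (0 : ℝ) 1,
      (x - c t) / (x - p) ∈ slitPlane := by
    intro x hx t ht
    have h1 := sub_div_sub_mem_slitPlane (hsub x hx t ht)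
    rwa [← neg_div_neg_eq, neg_sub, neg_sub] at h1
  have hslit1 := fun t ht => sub_div_sub_mem_slitPlane (hab t ht)
  have hcont : Continuous c := by fun_prop
  have hne : ∀ x ∈ segment ℝ a b, ∀ t ∈ Set.Icc (0 : ℝ) 1, x - c t ≠ 0 := by
    intro x hx t ht h0
    rw [sub_eq_zero] at h0
    exact hab t ht (h0 ▸ hx)
  have hc0 : c 0 = p := by simp [c]
  have hc1 : c 1 = q := by simp [c]
  have hz : (0 : ℝ) ∈ Set.Icc (0 : ℝ) 1 := by simp
  have ho : (1 : ℝ) ∈ Set.Icc (0 : ℝ) 1 := by simp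
  have hnep : ∀ x ∈ segment ℝ a b, x - p ≠ 0 := fun x hx => hc0 ▸ hne x hx 0 hz
  -- All quotients stay in the slit plane, so `F` is continuous; modulo full turns its terms cancel.
  let F : ℝ → ℝ := fun t => arg ((b - c t) / (a - c t)) - arg ((b - p) / (a - p)) -
    (arg ((b - c t) / (b - p)) - arg ((a - c t) / (a - p)))
  have hF1 : F 1 = 0 := by
    refine eq_zero_of_continuousOn_of_coe_angle_eq_zero (F := F) ?_ ?_ ?_
    · have c1 : ContinuousOn (fun t => arg ((b - c t) / (a - c t))) (Set.Icc 0 1) :=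
        continuousOn_arg.comp
          (ContinuousOn.div (by fun_prop) (by fun_prop) (hne a ha)) hslit1
      have c2 : ∀ x ∈ segment ℝ a b,
          ContinuousOn (fun t => arg ((x - c t) / (x - p))) (Set.Icc 0 1) := fun x hx =>
        continuousOn_arg.comp (by fun_prop) (hslit2 x hx)
      · exact (c1.sub continuousOn_const).sub ((c2 b hb).sub (c2 a ha))
    · simp [F, hc0, div_self (hnep a ha), div_self (hnep b hb)]
    · intro t ht
      simp only [F, Real.Angle.coe_sub]
      rw [arg_div_coe_angle (hne b hb t ht) (hne a ha t ht),
        arg_div_coe_angle (hnep b hb) (hnep a ha), arg_div_coe_angle (hne b hb t ht) (hnep b hb),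
        arg_div_coe_angle (hne a ha t ht) (hnep a ha)]
      abel
  have s1 := hslit1 1 ho
  have s0 := hslit1 0 hz
  have sa := hslit2 a ha 1 ho
  have sb := hslit2 b hb 1 ho
  simp only [F] at hF1
  rw [hc1] at s1 sa sb hF1
  rw [hc0] at s0
  rw [symArg_of_mem_slitPlane s1, symArg_of_mem_slitPlane s0, symArg_of_mem_slitPlane sa,
    symArg_of_mem_slitPlane sb]
  linarith

theorem add_ofReal_mem_slitPlane {w : ℂ} (hw : w ∈ slitPlane) {t : ℝ} (ht : 0 ≤ t) :
    w + t ∈ slitPlane := by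
  rw [mem_slitPlane_iff] at hw ⊢
  rcases hw with h | h
  · left
    simp
    linarith
  · right
    simpa using h

theorem add_ofReal_div_mem_slitPlane {w : ℂ} (hw : w ∈ slitPlane) {t : ℝ} (ht : 0 ≤ t) :
    (w + t) / w ∈ slitPlane := by
  have h0 := slitPlane_ne_zero hw
  refine div_mem_slitPlane h0 fun r hr h => ?_
  rw [mem_slitPlane_iff_not_le_zero] at hw
  apply hw
  have hc : (1 + r : ℝ) ≠ 0 := by positivity
  have hc' : (1 + r : ℂ) ≠ 0 := by exact_mod_cast hc
  have : w = ((- (t / (1 + r)) : ℝ) : ℂ) := by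
    push_cast
    field_simp
    linear_combination h
  rw [this]
  have : - (t / (1 + r)) ≤ 0 := by
    rw [neg_nonpos]
    positivity
  exact_mod_cast this

theorem symArg_add_one_of_mem_slitPlane {w : ℂ} (hw : w ∈ slitPlane) :
    symArg (w + 1) = symArg w + symArg ((w + 1) / w) := by
  have h0 := slitPlane_ne_zero hw
  let F : ℝ → ℝ := fun t => arg (w + t) - arg w - arg ((w + t) / w)
  have hF1 : F 1 = 0 := by
    refine eq_zero_of_continuousOn_of_coe_angle_eq_zero (F := F) ?_ ?_ ?_
    · have c1 : ContinuousOn (fun t : ℝ => arg (w + t)) (Set.Icc 0 1) :=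
        continuousOn_arg.comp (by fun_prop) fun t ht => add_ofReal_mem_slitPlane hw ht.1
      have c2 : ContinuousOn (fun t : ℝ => arg ((w + t) / w)) (Set.Icc 0 1) :=
        continuousOn_arg.comp (by fun_prop) fun t ht => add_ofReal_div_mem_slitPlane hw ht.1
      exact (c1.sub continuousOn_const).sub c2
    · simp [F, div_self h0]
    · intro t ht
      simp only [F, Real.Angle.coe_sub]
      rw [arg_div_coe_angle (slitPlane_ne_zero (add_ofReal_mem_slitPlane hw ht.1)) h0]
      abel
  have h1 := add_ofReal_mem_slitPlane hw zero_le_one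
  have h2 := add_ofReal_div_mem_slitPlane hw zero_le_one
  simp only [F] at hF1
  rw [ofReal_one] at h1 h2 hF1
  rw [symArg_of_mem_slitPlane h1, symArg_of_mem_slitPlane hw, symArg_of_mem_slitPlane h2]
  linarith

/-- The change of the angle under which the segment from `P` to `b` is seen while moving from `P`
to a point `p` that is not in the direction of `b`. -/
theorem symArg_segment_of_left {P p b : ℂ} (hp : P ≠ p)
    (h : (b - P) / (P - p) ∈ slitPlane ∨ ∃ r : ℝ, (b - P) / (P - p) = r) :
    symArg ((b - p) / (P - p)) - symArg ((b - P) / (P - P)) =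
      symArg ((b - P) / (P - p)) + (symArg ((b - p) / (b - P)) - symArg ((P - p) / (P - P))) := by
  have hPp : P - p ≠ 0 := sub_ne_zero.2 hp
  set w := (b - P) / (P - p) with hw
  have h1 : (b - p) / (P - p) = w + 1 := by
    rw [hw]
    field_simp
    ring
  have h2 : (b - p) / (b - P) = (w + 1) / w := by
    rw [← h1, hw, div_div_div_cancel_right₀ hPp]
  -- The degenerate quotients by `P - P` are `0` and contribute the angle `0`.
  rw [h1, h2, sub_self, div_zero, div_zero, symArg_zero, sub_zero, sub_zero]
  rcases h with h | ⟨r, hr⟩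
  · exact symArg_add_one_of_mem_slitPlane h
  · rw [hr]
    have a1 := symArg_ofReal (r + 1)
    have a2 := symArg_ofReal ((r + 1) / r)
    push_cast at a1 a2
    rw [a1, a2, symArg_ofReal, zero_add]

theorem symArg_segment_of_right {P p a : ℂ} (hp : P ≠ p)
    (h : (a - P) / (P - p) ∈ slitPlane ∨ ∃ r : ℝ, (a - P) / (P - p) = r) :
    symArg ((P - p) / (a - p)) - symArg ((P - P) / (a - P)) =
      - symArg ((a - P) / (P - p)) +
        (symArg ((P - p) / (P - P)) - symArg ((a - p) / (a - P))) := by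
  have := symArg_segment_of_left hp h
  rw [symArg_div_comm (P - p) (a - p), symArg_div_comm (P - P) (a - P)]
  linarith

/-! ### Counterclockwise angles between directions -/

theorem real_eq_of_coe_angle_eq {x y : ℝ} (h : (x : Real.Angle) = y)
    (h1 : x - y < 2 * Real.pi) (h2 : -(2 * Real.pi) < x - y) : x = y := by
  obtain ⟨n, hn⟩ := Real.Angle.angle_eq_iff_two_pi_dvd_sub.1 h
  have hpi := Real.pi_pos
  rw [hn] at h1 h2
  have a1 : (n : ℝ) < 1 := by nlinarith
  have a2 : (-1 : ℝ) < n := by nlinarith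
  have b1 : n < 1 := by exact_mod_cast a1
  have b2 : -1 < n := by exact_mod_cast a2
  have : n = 0 := by omega
  rw [this] at hn
  simp at hn
  linarith

theorem ccwAngle_pos (z w : ℂ) : 0 < ccwAngle z w :=
  left_lt_toIocMod _ _ _

theorem ccwAngle_le (z w : ℂ) : ccwAngle z w ≤ 2 * Real.pi := by
  simpa [ccwAngle] using toIocMod_le_right Real.two_pi_pos 0 (arg (w / z))

theorem coe_ccwAngle (z w : ℂ) : (ccwAngle z w : Real.Angle) = (arg (w / z) : Real.Angle) := by
  rw [Real.Angle.angle_eq_iff_two_pi_dvd_sub]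
  refine ⟨- toIocDiv Real.two_pi_pos 0 (arg (w / z)), ?_⟩
  have := self_sub_toIocMod Real.two_pi_pos 0 (arg (w / z))
  rw [zsmul_eq_mul] at this
  unfold ccwAngle
  push_cast
  linarith

theorem ccwAngle_self {z : ℂ} (hz : z ≠ 0) : ccwAngle z z = 2 * Real.pi := by
  unfold ccwAngle
  simp [div_self hz]

theorem symArg_div_neg {z w : ℂ} (h : w / (-z) ∈ slitPlane) :
    symArg (w / (-z)) = ccwAngle z w - Real.pi := by
  rw [symArg_of_mem_slitPlane h]
  have h0 := slitPlane_ne_zero h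
  have h1 := neg_pi_lt_arg (w / (-z))
  have h2 : arg (w / (-z)) < Real.pi :=
    lt_of_le_of_ne (arg_le_pi _) (mem_slitPlane_iff_arg.1 h).1
  have h3 := ccwAngle_pos z w
  have h4 := ccwAngle_le z w
  refine real_eq_of_coe_angle_eq ?_ (by linarith) (by linarith)
  rw [Real.Angle.coe_sub, coe_ccwAngle, div_neg, arg_neg_coe_angle, Real.Angle.sub_coe_pi_eq_add_coe_pi]
  rw [div_neg] at h0
  exact neg_ne_zero.1 h0

/-- The identity is clear modulo full turns. `hle` makes the right side non-negative, and `h`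
excludes equal directions, where the left side would be a full turn and the right side `0`. -/
theorem ccwAngle_eq_sub {z w w' : ℂ} (hz : z ≠ 0) (hle : ccwAngle z w' ≤ ccwAngle z w)
    (h : w / (-w') ∈ slitPlane) : ccwAngle w' w = ccwAngle z w - ccwAngle z w' := by
  have h0 := slitPlane_ne_zero h
  have hw : w ≠ 0 := fun h' => h0 (by simp [h'])
  have hw' : w' ≠ 0 := fun h' => h0 (by simp [h'])
  have h1 := symArg_div_neg h
  rw [symArg_of_mem_slitPlane h] at h1
  have h2 : arg (w / (-w')) < Real.pi :=
    lt_of_le_of_ne (arg_le_pi _) (mem_slitPlane_iff_arg.1 h).1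
  have h3 := ccwAngle_pos z w'
  have h4 := ccwAngle_le z w
  have h5 := ccwAngle_pos w' w
  refine real_eq_of_coe_angle_eq ?_ (by linarith) (by linarith)
  rw [Real.Angle.coe_sub, coe_ccwAngle, coe_ccwAngle, coe_ccwAngle, arg_div_coe_angle hw hw',
    arg_div_coe_angle hw hz, arg_div_coe_angle hw' hz]
  abel

end symArg

/-! ### Incidences of the polygonal arcs -/

namespace PlaneGraph

variable {V D : Type*} (G : PlaneGraph V D)

theorem pt_len (d : D) : G.pt d (G.len d) = G.pos (G.head d) := by
  have := G.pt_inv d 0 (Nat.zero_le _)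
  rw [G.pt_zero, Nat.sub_zero] at this
  exact this.symm

theorem pt_inv_reflect (d : D) {i : ℕ} (hi : i < G.len d) :
    G.pt (G.inv d) (G.len d - 1 - i) = G.pt d (i + 1) := by
  rw [G.pt_inv d _ (by omega)]
  congr 1
  omega

theorem pt_inv_reflect_succ (d : D) {i : ℕ} (hi : i < G.len d) :
    G.pt (G.inv d) (G.len d - 1 - i + 1) = G.pt d i := by
  rw [G.pt_inv d _ (by omega)]
  congr 1
  omega

/-- The point with parameter `t` on the `i`-th segment of `d`. -/
noncomputable def segPoint (d : D) (i : ℕ) (t : ℝ) : ℂ :=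
  AffineMap.lineMap (G.pt d i) (G.pt d (i + 1)) t

theorem segPoint_zero (d : D) (i : ℕ) : G.segPoint d i 0 = G.pt d i := by simp [segPoint]

theorem segPoint_one (d : D) (i : ℕ) : G.segPoint d i 1 = G.pt d (i + 1) := by simp [segPoint]

theorem segPoint_inv (d : D) {i : ℕ} (hi : i < G.len d) (t : ℝ) :
    G.segPoint (G.inv d) i t = G.segPoint d (G.len d - 1 - i) (1 - t) := by
  have h1 := G.pt_inv d i (by omega)
  have h2 := G.pt_inv d (i + 1) (by omega)
  have e1 : G.len d - 1 - i + 1 = G.len d - i := by omega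
  have e2 : G.len d - (i + 1) = G.len d - 1 - i := by omega
  rw [segPoint, segPoint, h1, h2, e1, e2, AffineMap.lineMap_apply_one_sub]

theorem pt_ne_pt_succ (d : D) {i : ℕ} (hi : i < G.len d) : G.pt d i ≠ G.pt d (i + 1) := by
  intro h
  have := G.inner_injective d d i hi i hi (1 / 3) (by norm_num) (1 / 2) (by norm_num)
    (by norm_num) (by norm_num) (by rw [h]; simp)
  rcases this with h' | h'
  · norm_num at h'
  · exact G.inv_ne d h'.symm

/-- Inner points determine their edge and their parameters, up to reversal. -/
theorem eq_or_eq_inv_of_segPoint_eq {d d₀ : D} {i i₀ : ℕ} (hi : i < G.len d) (hi₀ : i₀ < G.len d₀)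
    {t t₀ : ℝ} (ht : t ∈ Set.Ico (0 : ℝ) 1) (ht₀ : t₀ ∈ Set.Ico (0 : ℝ) 1)
    (hinner : ¬ (i = 0 ∧ t = 0)) (hinner₀ : ¬ (i₀ = 0 ∧ t₀ = 0))
    (h : G.segPoint d i t = G.segPoint d₀ i₀ t₀) :
    (d = d₀ ∧ i = i₀ ∧ t = t₀) ∨
      (d = G.inv d₀ ∧ ((t = 0 ∧ t₀ = 0 ∧ i + i₀ = G.len d₀) ∨
        (i + i₀ + 1 = G.len d₀ ∧ t = 1 - t₀))) := by
  rcases G.inner_injective d₀ d i₀ hi₀ i hi t₀ ht₀ t ht hinner₀ hinner h.symm with h1 | rfl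
  · exact Or.inl h1
  right
  refine ⟨rfl, ?_⟩
  rw [G.len_inv] at hi
  -- Reversal sends `t` to `1 - t`, which leaves the half-open range when `t = 0`; such a bend is
  -- instead the start of segment `len - i`.
  rcases eq_or_ne t 0 with rfl | hne
  · have hi0 : i ≠ 0 := fun h0 => hinner ⟨h0, rfl⟩
    have h2 : G.segPoint d₀ i₀ t₀ = G.segPoint d₀ (G.len d₀ - i) 0 := by
      rw [← h, segPoint_zero, segPoint_zero, G.pt_inv d₀ i hi.le]
    rcases G.inner_injective d₀ d₀ i₀ hi₀ _ (by omega) t₀ ht₀ 0 (by simp) hinner₀ (by omega) h2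
      with ⟨-, h3, h4⟩ | h3
    · exact Or.inl ⟨rfl, h4.symm, by omega⟩
    · exact absurd h3.symm (G.inv_ne d₀)
  · have htpos : 0 < t := lt_of_le_of_ne ht.1 hne.symm
    have h2 : G.segPoint d₀ i₀ t₀ = G.segPoint d₀ (G.len d₀ - 1 - i) (1 - t) := by
      rw [← h, G.segPoint_inv d₀ hi]
    rcases G.inner_injective d₀ d₀ i₀ hi₀ _ (by omega) t₀ ht₀ (1 - t)
      ⟨by linarith [ht.2], by linarith⟩ hinner₀ (fun h' => by linarith [ht.2, h'.2]) h2
      with ⟨-, h3, h4⟩ | h3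
    · exact Or.inr ⟨by omega, by linarith⟩
    · exact absurd h3.symm (G.inv_ne d₀)

/-- The value `t = 1` is allowed here: it is the start of the next segment or the head of `d`. -/
theorem segPoint_eq_cases {d d₀ : D} {i i₀ : ℕ} (hi : i < G.len d) (hi₀ : i₀ < G.len d₀)
    {t t₀ : ℝ} (ht : t ∈ Set.Icc (0 : ℝ) 1) (ht₀ : t₀ ∈ Set.Ico (0 : ℝ) 1)
    (h : G.segPoint d i t = G.segPoint d₀ i₀ t₀) :
    (d = d₀ ∧ i = i₀) ∨ (d = G.inv d₀ ∧ i + i₀ + 1 = G.len d₀) ∨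
      (t₀ = 0 ∧ (t = 0 ∨ t = 1)) := by
  by_cases h0 : i₀ = 0 ∧ t₀ = 0
  · obtain ⟨rfl, rfl⟩ := h0
    rw [segPoint_zero, G.pt_zero] at h
    by_cases h1 : t = 0 ∨ t = 1
    · exact Or.inr (Or.inr ⟨rfl, h1⟩)
    · push Not at h1
      exact absurd h (G.inner_ne_pos d i hi t ⟨ht.1, lt_of_le_of_ne ht.2 h1.2⟩
        (fun h' => h1.1 h'.2) _)
  rcases eq_or_ne t 1 with rfl | ht1
  · rw [segPoint_one] at h
    rcases Nat.lt_or_ge (i + 1) (G.len d) with hlt | hge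
    · rw [← segPoint_zero] at h
      rcases G.eq_or_eq_inv_of_segPoint_eq hlt hi₀ (by simp) ht₀ (by simp) h0 h with
        ⟨-, -, h2⟩ | ⟨-, ⟨-, h2, -⟩ | ⟨-, h2⟩⟩
      · exact Or.inr (Or.inr ⟨h2.symm, Or.inr rfl⟩)
      · exact Or.inr (Or.inr ⟨h2, Or.inr rfl⟩)
      · linarith [ht₀.2]
    · have : i + 1 = G.len d := by omega
      rw [this, pt_len] at h
      exact absurd h.symm (G.inner_ne_pos d₀ i₀ hi₀ t₀ ht₀ h0 _)
  · have ht' : t ∈ Set.Ico (0 : ℝ) 1 := ⟨ht.1, lt_of_le_of_ne ht.2 ht1⟩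
    by_cases h1 : i = 0 ∧ t = 0
    · obtain ⟨rfl, rfl⟩ := h1
      rw [segPoint_zero, G.pt_zero] at h
      exact absurd h.symm (G.inner_ne_pos d₀ i₀ hi₀ t₀ ht₀ h0 _)
    · rcases G.eq_or_eq_inv_of_segPoint_eq hi hi₀ ht' ht₀ h1 h0 h with
        ⟨h2, h3, -⟩ | ⟨h2, ⟨h3, h4, -⟩ | ⟨h3, -⟩⟩
      · exact Or.inl ⟨h2, h3⟩
      · exact Or.inr (Or.inr ⟨h4, Or.inl h3⟩)
      · exact Or.inr (Or.inl ⟨h2, h3⟩)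

/-- Different segments leave a common end in different directions. -/
theorem direction_ne {d d₀ : D} {i i₀ : ℕ} (hi : i < G.len d) (hi₀ : i₀ < G.len d₀)
    (h1 : ¬ (d = d₀ ∧ i = i₀)) (h2 : ¬ (d = G.inv d₀ ∧ i + i₀ + 1 = G.len d₀))
    (hP : G.pt d i = G.pt d₀ i₀) {r : ℝ} (hr : 0 ≤ r) :
    G.pt d (i + 1) - G.pt d₀ i₀ ≠ r * (G.pt d₀ (i₀ + 1) - G.pt d₀ i₀) := by
  intro h
  have hr0 : 0 < r := by
    refine lt_of_le_of_ne hr fun h0 => ?_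
    rw [← h0, ← hP] at h
    simp only [Complex.ofReal_zero, zero_mul, sub_eq_zero] at h
    exact G.pt_ne_pt_succ d hi h.symm
  -- In a common direction with length ratio `r`, the parameters `1 / (r + 1)` and `r / (r + 1)`
  -- give the same inner point of both segments.
  have hδ : (1 / (r + 1) : ℝ) < 1 := by
    rw [div_lt_one (by positivity)]
    linarith
  have hδr : (1 / (r + 1) * r : ℝ) < 1 := by
    rw [div_mul_eq_mul_div, div_lt_one (by positivity)]
    linarith
  rcases G.segPoint_eq_cases hi hi₀ (t := 1 / (r + 1)) (t₀ := 1 / (r + 1) * r)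
    ⟨by positivity, hδ.le⟩ ⟨by positivity, hδr⟩ (by
      rw [segPoint, segPoint, lineMap_eq, lineMap_eq, hP, h]
      push_cast
      ring) with h' | h' | ⟨h', -⟩
  · exact h1 h'
  · exact h2 h'
  · have : (0 : ℝ) < 1 / (r + 1) * r := by positivity
    exact this.ne' h'

noncomputable def mid (d : D) (i : ℕ) : ℂ := G.segPoint d i (1 / 2)

theorem pt_sub_mid (d : D) (i : ℕ) :
    G.pt d i - G.mid d i = (1 / 2 : ℝ) * -(G.pt d (i + 1) - G.pt d i) := by
  rw [mid, segPoint, lineMap_eq]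
  push_cast
  ring

theorem pt_ne_mid (d : D) {i : ℕ} (hi : i < G.len d) : G.pt d i ≠ G.mid d i := by
  rw [← sub_ne_zero, pt_sub_mid]
  exact mul_ne_zero (by norm_num) (neg_ne_zero.2 (sub_ne_zero.2 (G.pt_ne_pt_succ d hi).symm))

theorem mid_inv (d : D) {i : ℕ} (hi : i < G.len d) :
    G.mid (G.inv d) i = G.mid d (G.len d - 1 - i) := by
  rw [mid, mid, G.segPoint_inv d hi]
  norm_num

theorem direction_mem_slitPlane {d d₀ : D} {i i₀ : ℕ} (hi : i < G.len d) (hi₀ : i₀ < G.len d₀)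
    (h1 : ¬ (d = d₀ ∧ i = i₀)) (h2 : ¬ (d = G.inv d₀ ∧ i + i₀ + 1 = G.len d₀))
    (hP : G.pt d i = G.pt d₀ i₀) :
    (G.pt d (i + 1) - G.pt d₀ i₀) / (G.pt d₀ i₀ - G.mid d₀ i₀) ∈ Complex.slitPlane := by
  refine div_mem_slitPlane (sub_ne_zero.2 (G.pt_ne_mid d₀ hi₀)) fun r hr h => ?_
  refine G.direction_ne hi hi₀ h1 h2 hP (r := r * (1 / 2)) (by positivity) ?_
  rw [h, pt_sub_mid]
  push_cast
  ring

/-- Moving from the end `P` of a segment to its midpoint changes the angle under which a segment is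
seen by a difference of a function of the ends and by terms for the segments ending in `P`. -/
theorem symArg_segment_sub {d d₀ : D} {i i₀ : ℕ} (hi : i < G.len d) (hi₀ : i₀ < G.len d₀) :
    letI P := G.pt d₀ i₀
    letI m := G.mid d₀ i₀
    symArg ((G.pt d (i + 1) - m) / (G.pt d i - m)) -
        symArg ((G.pt d (i + 1) - P) / (G.pt d i - P)) =
      (if G.pt d i = P then symArg ((G.pt d (i + 1) - P) / (P - m)) else 0) -
      (if G.pt d (i + 1) = P then symArg ((G.pt d i - P) / (P - m)) else 0) +
      (symArg ((G.pt d (i + 1) - m) / (G.pt d (i + 1) - P)) -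
        symArg ((G.pt d i - m) / (G.pt d i - P))) := by
  have hne := G.pt_ne_pt_succ d hi
  have hm := G.pt_ne_mid d₀ hi₀
  by_cases hA : G.pt d i = G.pt d₀ i₀
  · have hB : G.pt d (i + 1) ≠ G.pt d₀ i₀ := fun h => hne (hA.trans h.symm)
    rw [if_pos hA, if_neg hB, sub_zero, hA]
    refine symArg_segment_of_left hm ?_
    by_cases h1 : d = d₀ ∧ i = i₀
    · obtain ⟨rfl, rfl⟩ := h1
      refine Or.inr ⟨-2, ?_⟩
      rw [div_eq_iff (sub_ne_zero.2 hm), pt_sub_mid]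
      push_cast
      ring
    · refine Or.inl (G.direction_mem_slitPlane hi hi₀ h1 ?_ hA)
      rintro ⟨rfl, hlen⟩
      have h4 := G.pt_inv_reflect_succ d₀ hi₀
      rw [show G.len d₀ - 1 - i₀ = i by omega] at h4
      exact hB h4
  by_cases hB : G.pt d (i + 1) = G.pt d₀ i₀
  · rw [if_neg hA, if_pos hB, zero_sub, hB]
    refine symArg_segment_of_right hm ?_
    have r1 := G.pt_inv_reflect d hi
    have r2 := G.pt_inv_reflect_succ d hi
    by_cases h1 : G.inv d = d₀ ∧ G.len d - 1 - i = i₀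
    · obtain ⟨rfl, rfl⟩ := h1
      refine Or.inr ⟨-2, ?_⟩
      rw [div_eq_iff (sub_ne_zero.2 hm), pt_sub_mid, r1, r2]
      push_cast
      ring
    · rw [← r2]
      refine Or.inl (G.direction_mem_slitPlane (by rw [G.len_inv]; omega) hi₀ h1 ?_
        (r1.trans hB))
      rintro ⟨h3, hlen⟩
      obtain rfl := G.inv_involutive.injective h3
      exact hA (by rw [show i = i₀ by omega])
  rw [if_neg hA, if_neg hB, sub_zero, zero_add]
  refine symArg_sub_symArg_of_disjoint ?_
  rw [Set.disjoint_left]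
  intro x hx hx₀
  rw [segment_eq_image_lineMap] at hx hx₀
  obtain ⟨t, ht, rfl⟩ := hx
  obtain ⟨t₀, ht₀, hx₀⟩ := hx₀
  -- The path from `P` to the midpoint is the first half of the segment.
  have hx1 : G.segPoint d i t = G.segPoint d₀ i₀ (t₀ / 2) := by
    rw [segPoint, ← hx₀, segPoint, mid, segPoint, lineMap_eq, lineMap_eq, lineMap_eq]
    push_cast
    ring
  rcases G.segPoint_eq_cases hi hi₀ ht ⟨by linarith [ht₀.1], by linarith [ht₀.2]⟩ hx1 with
    ⟨rfl, rfl⟩ | ⟨rfl, hlen⟩ | ⟨h0, rfl | rfl⟩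
  · exact hA rfl
  · have h4 := G.pt_inv_reflect_succ d₀ hi₀
    have h5 := G.pt_inv_reflect d₀ hi₀
    rw [show G.len d₀ - 1 - i₀ = i by omega] at h4
    exact hB h4
  · rw [h0, segPoint_zero, segPoint_zero] at hx1
    exact hA hx1
  · rw [h0, segPoint_zero, segPoint_one] at hx1
    exact hB hx1

/-! ### Angle sums as winding numbers -/

/-- The total angle, with weights `z`, under which the edges are seen from `p`. -/
noncomputable def angleSum (z : D → ℝ) (p : ℂ) : ℝ :=
  ∑' d, z d * ∑ i ∈ Finset.range (G.len d), symArg ((G.pt d (i + 1) - p) / (G.pt d i - p))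

open Classical in
/-- The jump of `angleSum` when moving from a vertex or a bend `P` along a segment. -/
theorem angleSum_mid_sub (hG : G.LocallyFinite) {z : D → ℝ} (hfin : z.support.Finite)
    (hz : G.IsFlow z) {d₀ : D} {i₀ : ℕ} (hi₀ : i₀ < G.len d₀) :
    G.angleSum z (G.mid d₀ i₀) - G.angleSum z (G.pt d₀ i₀) =
      2 * ∑' d, z d * ∑ i ∈ Finset.range (G.len d), if G.pt d i = G.pt d₀ i₀ then
        symArg ((G.pt d (i + 1) - G.pt d₀ i₀) / (G.pt d₀ i₀ - G.mid d₀ i₀)) else 0 := by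
  have summ : ∀ F : D → ℝ, Summable fun d => z d * F d :=
    fun F => Multigraph.summable_mul_of_finite_support hfin F
  let A : D → ℝ := fun d => ∑ i ∈ Finset.range (G.len d), if G.pt d i = G.pt d₀ i₀ then
    symArg ((G.pt d (i + 1) - G.pt d₀ i₀) / (G.pt d₀ i₀ - G.mid d₀ i₀)) else 0
  let B : D → ℝ := fun d => ∑ i ∈ Finset.range (G.len d), if G.pt d (i + 1) = G.pt d₀ i₀ then
    symArg ((G.pt d i - G.pt d₀ i₀) / (G.pt d₀ i₀ - G.mid d₀ i₀)) else 0
  -- These terms telescope along each edge to a gradient, to which the flow `z` is orthogonal.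
  let τ : ℂ → ℝ := fun x => symArg ((x - G.mid d₀ i₀) / (x - G.pt d₀ i₀))
  have hterm : ∀ d,
      (∑ i ∈ Finset.range (G.len d),
        symArg ((G.pt d (i + 1) - G.mid d₀ i₀) / (G.pt d i - G.mid d₀ i₀))) -
      (∑ i ∈ Finset.range (G.len d),
        symArg ((G.pt d (i + 1) - G.pt d₀ i₀) / (G.pt d i - G.pt d₀ i₀))) =
      A d - B d + (τ (G.pos (G.head d)) - τ (G.pos (G.tail d))) := by
    intro d
    rw [← Finset.sum_sub_distrib, Finset.sum_congr rfl fun i hi =>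
      G.symArg_segment_sub (Finset.mem_range.1 hi) hi₀, Finset.sum_add_distrib,
      Finset.sum_sub_distrib, Finset.sum_range_sub (fun i => τ (G.pt d i)), G.pt_len, G.pt_zero]
  -- Reversal exchanges segments starting and ending at the point; as `z` is antisymmetric, both
  -- kinds contribute equally, whence the factor `2`.
  have hBA : ∀ d, B (G.inv d) = A d := by
    intro d
    simp only [A, B]
    rw [G.len_inv, ← Finset.sum_range_reflect]
    refine Finset.sum_congr rfl fun i hi => ?_
    rw [G.pt_inv_reflect d (Finset.mem_range.1 hi), G.pt_inv_reflect_succ d (Finset.mem_range.1 hi)]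
  have hB : ∑' d, z d * B d = - ∑' d, z d * A d := by
    rw [← G.invEquiv.tsum_eq, ← tsum_neg]
    refine tsum_congr fun d => ?_
    rw [G.invEquiv_apply, hz.antisymm, hBA, neg_mul]
  have hτ := hz.tsum_mul_head_sub_tail hG hfin fun x => τ (G.pos x)
  rw [angleSum, angleSum, ← (summ _).tsum_sub (summ _)]
  simp only [← mul_sub, hterm]
  simp only [mul_add, mul_sub (z _) (A _)]
  rw [((summ _).sub (summ _)).tsum_add (summ _), (summ _).tsum_sub (summ _), hτ, hB]
  simp only [A]
  ring

theorem pt_eq_bend {d d₀ : D} {i i₀ : ℕ} (hi : i < G.len d) (hi₀ : i₀ < G.len d₀)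
    (h0 : i₀ ≠ 0) (h : G.pt d i = G.pt d₀ i₀) :
    (d = d₀ ∧ i = i₀) ∨ (d = G.inv d₀ ∧ i + i₀ = G.len d₀) := by
  rw [← segPoint_zero, ← segPoint_zero] at h
  by_cases h1 : i = 0
  · subst h1
    rw [segPoint_zero, G.pt_zero] at h
    exact absurd h.symm (G.inner_ne_pos d₀ i₀ hi₀ 0 (by simp) (by simp [h0]) _)
  rcases G.eq_or_eq_inv_of_segPoint_eq hi hi₀ (by simp) (by simp) (by simp [h1]) (by simp [h0]) h with
    ⟨h2, h3, -⟩ | ⟨h2, ⟨-, -, h3⟩ | ⟨-, h3⟩⟩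
  · exact Or.inl ⟨h2, h3⟩
  · exact Or.inr ⟨h2, h3⟩
  · norm_num at h3

theorem symArg_div_pt_sub_mid (x : ℂ) (d : D) (i : ℕ) :
    symArg (x / (G.pt d i - G.mid d i)) = symArg (x / -(G.pt d (i + 1) - G.pt d i)) := by
  rw [pt_sub_mid, ← symArg_real_mul (r := 1 / 2) (by norm_num) (x / _)]
  congr 1
  push_cast
  field_simp

-- Only `d` and its reverse pass through a bend, and the segment of `d` itself contributes `symArg
-- (-1) = 0`.
open Classical in
theorem angleSum_mid_sub_bend (hG : G.LocallyFinite) {z : D → ℝ} (hfin : z.support.Finite)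
    (hz : G.IsFlow z) {d : D} {i : ℕ} (hi : i < G.len d) (h0 : i ≠ 0) :
    G.angleSum z (G.mid d i) - G.angleSum z (G.pt d i) =
      - (2 * z d * symArg ((G.pt d (i - 1) - G.pt d i) / -(G.pt d (i + 1) - G.pt d i))) := by
  rw [G.angleSum_mid_sub hG hfin hz hi]
  simp only [symArg_div_pt_sub_mid]
  have hne : d ≠ G.inv d := (G.inv_ne d).symm
  have hback : G.pt (G.inv d) (G.len d - i) = G.pt d i := by
    rw [G.pt_inv d _ (by omega)]
    congr 1
    omega
  have hback' : G.pt (G.inv d) (G.len d - i + 1) = G.pt d (i - 1) := by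
    rw [G.pt_inv d _ (by omega)]
    congr 1
    omega
  rw [tsum_eq_sum (s := {d, G.inv d}), Finset.sum_pair hne, Finset.sum_eq_single_of_mem i
    (Finset.mem_range.2 hi), Finset.sum_eq_single_of_mem (G.len d - i), if_pos rfl,
    if_pos hback, hback', hz.antisymm]
  · have h1 : symArg ((G.pt d (i + 1) - G.pt d i) / -(G.pt d (i + 1) - G.pt d i)) = 0 := by
      rw [div_neg, div_self (sub_ne_zero.2 (G.pt_ne_pt_succ d hi).symm)]
      exact_mod_cast symArg_ofReal (-1)
    rw [h1]
    ring
  · rw [Finset.mem_range, G.len_inv]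
    omega
  · intro j hj hji
    refine if_neg fun h => ?_
    rcases G.pt_eq_bend (Finset.mem_range.1 hj) hi h0 h with ⟨h1, -⟩ | ⟨-, h1⟩
    · exact hne h1.symm
    · omega
  · intro j hj hji
    refine if_neg fun h => ?_
    rcases G.pt_eq_bend (Finset.mem_range.1 hj) hi h0 h with ⟨-, h1⟩ | ⟨h1, -⟩
    · exact hji h1
    · exact hne h1
  · intro e he
    rw [Finset.sum_eq_zero, mul_zero]
    intro j hj
    refine if_neg fun h => he ?_
    rcases G.pt_eq_bend (Finset.mem_range.1 hj) hi h0 h with ⟨h1, -⟩ | ⟨h1, -⟩ <;> simp [h1]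

/-- The sum of the angles does not change at the bends of an edge. -/
theorem angleSum_mid_succ (hG : G.LocallyFinite) {z : D → ℝ} (hfin : z.support.Finite)
    (hz : G.IsFlow z) {d : D} {i : ℕ} (hi : i + 1 < G.len d) :
    G.angleSum z (G.mid d (i + 1)) = G.angleSum z (G.mid d i) := by
  have h1 := G.angleSum_mid_sub_bend hG hfin hz hi (by omega)
  -- This is the same bend, left along the preceding segment. Flow and angle both change sign, so
  -- the two jumps agree.
  have h2 := G.angleSum_mid_sub_bend hG hfin hz (d := G.inv d) (i := G.len d - 1 - i)
    (by rw [G.len_inv]; omega) (by omega)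
  have e1 : G.pt (G.inv d) (G.len d - 1 - i - 1) = G.pt d (i + 1 + 1) := by
    rw [G.pt_inv d _ (by omega)]
    congr 1
    omega
  rw [G.mid_inv d (by omega), G.pt_inv_reflect d (by omega), G.pt_inv_reflect_succ d (by omega),
    e1, hz.antisymm, show G.len d - 1 - (G.len d - 1 - i) = i by omega, div_neg, ← neg_div,
    symArg_div_comm, div_neg, ← neg_div] at h2
  rw [Nat.add_sub_cancel, div_neg, ← neg_div] at h1
  linear_combination h1 - h2

theorem angleSum_mid_inv (hG : G.LocallyFinite) {z : D → ℝ} (hfin : z.support.Finite)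
    (hz : G.IsFlow z) (d : D) :
    G.angleSum z (G.mid (G.inv d) 0) = G.angleSum z (G.mid d 0) := by
  have hpos := G.len_pos d
  have h : ∀ i < G.len d, G.angleSum z (G.mid d i) = G.angleSum z (G.mid d 0) := by
    intro i
    induction i with
    | zero => exact fun _ => rfl
    | succ i ih => exact fun hi => (G.angleSum_mid_succ hG hfin hz hi).trans (ih (by omega))
  rw [G.mid_inv d hpos]
  exact h _ (by omega)

/-- The direction in which `d` leaves its tail. -/
noncomputable def dir (d : D) : ℂ := G.pt d 1 - G.pt d 0

theorem dir_ne_zero (d : D) : G.dir d ≠ 0 :=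
  sub_ne_zero.2 (G.pt_ne_pt_succ d (G.len_pos d)).symm

theorem dir_div_neg_mem_slitPlane {d e : D} (hne : e ≠ d) (ht : G.tail e = G.tail d) :
    G.dir e / -G.dir d ∈ Complex.slitPlane := by
  have hP : G.pt e 0 = G.pt d 0 := by rw [G.pt_zero, G.pt_zero, ht]
  refine div_mem_slitPlane (neg_ne_zero.2 (G.dir_ne_zero d)) fun r hr h => ?_
  refine G.direction_ne (G.len_pos e) (G.len_pos d) (fun h' => hne h'.1) ?_ hP hr ?_
  · rintro ⟨rfl, hlen⟩
    refine G.pt_ne_pt_succ d (G.len_pos d) ?_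
    rw [show 0 + 1 = G.len d by omega, G.pt_len, G.pt_zero]
    exact congrArg G.pos ht.symm
  · rw [← hP]
    refine h.trans ?_
    rw [dir, hP]
    ring

open Classical in
/-- The sum of the angles seen from the left side of `d`, in terms of the counterclockwise angles
at the tail of `d`. -/
theorem angleSum_mid_add (hG : G.LocallyFinite) {z : D → ℝ} (hfin : z.support.Finite)
    (hz : G.IsFlow z) (d : D) :
    G.angleSum z (G.mid d 0) + 2 * Real.pi * z d = G.angleSum z (G.pos (G.tail d)) +
      2 * ∑' e, z e * if G.tail e = G.tail d then ccwAngle (G.dir d) (G.dir e) else 0 := by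
  have summ : ∀ F : D → ℝ, Summable fun d => z d * F d :=
    fun F => Multigraph.summable_mul_of_finite_support hfin F
  have h1 := G.angleSum_mid_sub hG hfin hz (G.len_pos d)
  simp only [symArg_div_pt_sub_mid] at h1
  -- For `e = d` the counterclockwise angle is a full turn while `symArg (-1) = 0`, hence the extra
  -- `π`; it produces the term `2 * π * z d`.
  have h2 : ∀ e, (∑ i ∈ Finset.range (G.len e), if G.pt e i = G.pt d 0 then
        symArg ((G.pt e (i + 1) - G.pt d 0) / -(G.pt d (0 + 1) - G.pt d 0)) else 0) =
      (if G.tail e = G.tail d then ccwAngle (G.dir d) (G.dir e) else 0) -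
        Real.pi * (if G.tail e = G.tail d then 1 else 0) -
        if e = d then Real.pi else 0 := by
    intro e
    rw [Finset.sum_eq_single_of_mem 0 (Finset.mem_range.2 (G.len_pos e))]
    · by_cases ht : G.tail e = G.tail d
      · have hP : G.pt e 0 = G.pt d 0 := by rw [G.pt_zero, G.pt_zero, ht]
        rw [if_pos ht, if_pos ht, if_pos hP]
        nth_rewrite 1 [← hP]
        change symArg (G.dir e / -G.dir d) = _
        by_cases hed : e = d
        · subst hed
          rw [if_pos rfl, ccwAngle_self (G.dir_ne_zero e), div_neg, div_self (G.dir_ne_zero e)]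
          have := symArg_ofReal (-1)
          push_cast at this
          rw [this]
          ring
        · rw [if_neg hed, symArg_div_neg (G.dir_div_neg_mem_slitPlane hed ht)]
          ring
      · have hed : e ≠ d := fun h => ht (h ▸ rfl)
        have hP : G.pt e 0 ≠ G.pt d 0 := by
          rwa [G.pt_zero, G.pt_zero, Ne, G.pos_injective.eq_iff]
        rw [if_neg ht, if_neg ht, if_neg hP, if_neg hed]
        ring
    · intro i hi hi0
      refine if_neg fun h => ?_
      rw [G.pt_zero d, ← segPoint_zero] at h
      exact G.inner_ne_pos e i (Finset.mem_range.1 hi) 0 (by simp) (by simp [hi0]) _ h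
  simp only [h2] at h1
  have h3 : ∑' e, z e * (if e = d then Real.pi else 0) = z d * Real.pi := by
    rw [tsum_eq_single d fun e he => by simp [he]]
    simp
  have h4 : ∑' e, z e * (Real.pi * (if G.tail e = G.tail d then 1 else 0)) = 0 :=
    hz.tsum_mul_tail_eq_zero hG hfin fun x => Real.pi * if x = G.tail d then 1 else 0
  simp only [mul_sub (z _)] at h1
  rw [((summ _).sub (summ _)).tsum_sub (summ _), (summ _).tsum_sub (summ _), h3, h4,
    G.pt_zero] at h1
  linarith

/-- A finite flow in a plane graph is the boundary of a function on the faces: every edge carries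
the difference of the winding numbers on its two sides. -/
theorem exists_face_function (hG : G.LocallyFinite) {z : D → ℝ} (hfin : z.support.Finite)
    (hz : G.IsFlow z) : ∃ s : D → ℝ,
      (∀ d, s (G.facePerm d) = s d) ∧ ∀ d, s d - s (G.inv d) = z d := by
  classical
  have hpi := Real.pi_pos
  have summ : ∀ F : D → ℝ, Summable fun d => z d * F d :=
    fun F => Multigraph.summable_mul_of_finite_support hfin F
  -- Both darts of an edge are counted, so a full turn weighs `4π`. On the edge the normalised sum
  -- is the mean of the two sides, and adding `z d / 2` gives the left one.
  let s : D → ℝ := fun d => (G.angleSum z (G.mid d 0) + 2 * Real.pi * z d) / (4 * Real.pi)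
  have hs : ∀ d, s d - s (G.inv d) = z d := by
    intro d
    simp only [s]
    rw [G.angleSum_mid_inv hG hfin hz, hz.antisymm]
    field_simp
    ring
  have hrot : ∀ d, s (G.rot d) - z (G.rot d) = s d := by
    intro d
    have ht : G.tail (G.rot d) = G.tail d := G.toRotationSystem.tail_rot d
    have h0 := hz.tsum_mul_tail_eq_zero hG hfin fun x =>
      if x = G.tail d then ccwAngle (G.dir d) (G.dir (G.rot d)) else 0
    -- Turning the reference direction from `d` to `rot d` passes no other dart, so all angles drop
    -- by the same amount, except that `rot d` itself gets a full turn instead of `0`. Kirchhoff's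
    -- law removes the common amount.
    have h1 : ∀ e, (if G.tail e = G.tail d then ccwAngle (G.dir (G.rot d)) (G.dir e) else 0) =
        (if G.tail e = G.tail d then ccwAngle (G.dir d) (G.dir e) else 0) -
        (if G.tail e = G.tail d then ccwAngle (G.dir d) (G.dir (G.rot d)) else 0) +
        if e = G.rot d then 2 * Real.pi else 0 := by
      intro e
      by_cases hed : e = G.rot d
      · subst hed
        simp [ht, ccwAngle_self (G.dir_ne_zero _)]
      · by_cases hte : G.tail e = G.tail d
        · simp only [if_pos hte, if_neg hed, add_zero]
          exact ccwAngle_eq_sub (G.dir_ne_zero d) (G.rot_ccw d e hte)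
            (G.dir_div_neg_mem_slitPlane hed (hte.trans ht.symm))
        · simp [hte, hed]
    have h2 : ∑' e, z e * (if e = G.rot d then 2 * Real.pi else 0) =
        z (G.rot d) * (2 * Real.pi) := by
      rw [tsum_eq_single (G.rot d) fun e he => by simp [he]]
      simp
    have h3 : G.angleSum z (G.mid (G.rot d) 0) + 2 * Real.pi * z (G.rot d) =
        G.angleSum z (G.mid d 0) + 2 * Real.pi * z d + 4 * Real.pi * z (G.rot d) := by
      rw [G.angleSum_mid_add hG hfin hz, G.angleSum_mid_add hG hfin hz, ht]
      simp only [h1, mul_add, mul_sub]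
      rw [((summ _).sub (summ _)).tsum_add (summ _), (summ _).tsum_sub (summ _), h0, h2]
      ring
    simp only [s]
    rw [h3]
    field_simp
    ring
  refine ⟨s, fun d => ?_, hs⟩
  have h1 := hrot (G.facePerm d)
  have h2 : G.rot (G.facePerm d) = G.inv d := by
    simp [RotationSystem.facePerm]
  rw [h2, hz.antisymm] at h1
  linarith [hs d]

end PlaneGraph

/-! ### Conclusion -/

theorem mainTheorem7 {V D : Type*} (G : PlaneGraph V D)
    (hG : G.LocallyFinite) (hGdual : G.dual.LocallyFinite)
    (f h : RoundaboutDart D → ℝ)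
    (hf : G.roundabout.IsFlow f) (hfE : FiniteEnergy f)
    (hh : G.dual.roundabout.IsFlow h) (hhE : FiniteEnergy h)
    (hsupp : ∃ e : D,
      {d : D | f (RoundaboutDart.edge d) ≠ 0 ∧ h (RoundaboutDart.edge d) ≠ 0} = {e, G.inv e}) :
    ∃ u : V → ℝ, G.IsDirichletHarmonic u ∧ ∃ x y, u x ≠ u y := by
  classical
  obtain ⟨e, he⟩ := hsupp
  refine RotationSystem.exists_dirichletHarmonic hG
    (fun z hfin hz => G.exists_face_function hG hfin hz) hf hfE hh hhE ?_
  have hfa : f (.edge (G.inv e)) = - f (.edge e) := hf.antisymm (.edge e)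
  have hha : h (.edge (G.inv e)) = - h (.edge e) := hh.antisymm (.edge e)
  have hmem : f (.edge e) ≠ 0 ∧ h (.edge e) ≠ 0 := by
    have : e ∈ ({e, G.inv e} : Set D) := Or.inl rfl
    rwa [← he] at this
  -- The two darts of the common edge contribute equal products, so they cannot cancel.
  rw [tsum_eq_sum (s := {e, G.inv e}), Finset.sum_pair (G.inv_ne e).symm, hfa, hha]
  · have := mul_ne_zero hmem.1 hmem.2
    intro h0
    apply this
    linarith
  · intro d hd
    by_contra hne
    have h1 : d ∈ ({e, G.inv e} : Set D) := by
      rw [← he]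
      exact ⟨left_ne_zero_of_mul hne, right_ne_zero_of_mul hne⟩
    exact hd (by simpa using h1)
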